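/- All logarithms $\log$ are to base $2$, and $\ln$ is the natural logarithm. For a density matrix $\rho$ let $H(\rho)$ be its von Neumann entropy, and for a bipartite state on $X\otimes B$ let $I(X;B)=H(X)+H(B)-H(XB)$, where $H(X)$ and $H(B)$ are the entropies of the reduced states. For a state $\rho^{XE}$ whose register $X$ is classical, the accessible information is $I_{\mathrm{acc}}(X;E)=\sup_\Gamma I(X;Y)$, where $\Gamma$ runs over all POVMs with finitely many outcomes on $E$ and $I(X;Y)$ is the Shannon mutual information of $X$ and the outcome $Y$. Let $\mathcal N:A\to B$ be a quantum channel between finite-dimensional systems, and let $V:A\to B\otimes E$ be an isometry with $\mathcal N(\rho)=\mathrm{tr}_E(V\rho V^\dagger)$. The locking information of $\mathcal N$ is $$\mathcal L_u^{(1)}(\mathcal N)=\sup_{\rho}\bigl(I(X;B)-I_{\mathrm{acc}}(X;E)\bigr),$$ where the supremum is over all classical-quantum states $\rho^{XA}=\sum_x p_x|x\rangle\langle x|^X\otimes\rho_x^A$ with a finite classical register $X$, and the quantities are evaluated on $(1_X\otimes V)\rho^{XA}(1_X\otimes V)^\dagger$ (the value does not depend on the choice of $V$). For $d\ge 1$ and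 $0\le p\le 1$ let $\mathcal E_{p,d}$ be the $d$-dimensional erasure channel, with input space $\mathbb C^d$ and output space $\mathbb C^d\oplus\mathbb C|e\rangle$, defined by $\mathcal E_{p,d}(\rho)=(1-p)\rho+p\,\mathrm{tr}(\rho)\,|e\rangle\langle e|$, and put $\gamma_d=\ln d-\sum_{t=2}^d \frac1t$. Then for every integer $d\ge1$ and every $0\le p\le\frac12$, $$\mathcal L_u^{(1)}(\mathcal E_{p,d})\le(1-p)\log d-p\,\gamma_d\log e .$$ Moreover $\lim_{d\to\infty}\gamma_d=1-\gamma$, where $\gamma=\lim_{n\to\infty}\bigl(\sum_{t=1}^n\frac1t-\ln n\bigr)$ is Euler's constant. -/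

import Mathlib

open scoped Kronecker ComplexOrder

namespace QInfo

noncomputable section

/-- Shannon entropy `∑ i, -q i * log₂ (q i)`, in bits, of a finite probability vector. -/
def shannonEntropy {ι : Type*} [Fintype ι] (q : ι → ℝ) : ℝ :=
  ∑ i, -(q i * Real.logb 2 (q i))

/-- Shannon mutual information `I(X;Y) = H(X) + H(Y) - H(XY)` of a joint distribution. -/
def shannonMutualInfo {ι κ : Type*} [Fintype ι] [Fintype κ] (P : ι × κ → ℝ) : ℝ :=
  shannonEntropy (fun x => ∑ y, P (x, y)) + shannonEntropy (fun y => ∑ x, P (x, y))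
    - shannonEntropy P

open Classical in
/-- Von Neumann entropy, in bits: the Shannon entropy of the spectrum
(only meant for density matrices, which are Hermitian). -/
def vonNeumannEntropy {n : Type*} [Fintype n] [DecidableEq n] (ρ : Matrix n n ℂ) : ℝ :=
  if h : ρ.IsHermitian then shannonEntropy h.eigenvalues else 0

/-- Density matrices. -/
def IsDensity {n : Type*} [Fintype n] (ρ : Matrix n n ℂ) : Prop :=
  ρ.PosSemidef ∧ ρ.trace = 1

/-- Partial trace over the first tensor factor. -/
def traceFst {m n : Type*} [Fintype m] (ρ : Matrix (m × n) (m × n) ℂ) : Matrix n n ℂ :=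
  Matrix.of fun i j => ∑ k, ρ (k, i) (k, j)

/-- Partial trace over the second tensor factor. -/
def traceSnd {m n : Type*} [Fintype n] (ρ : Matrix (m × n) (m × n) ℂ) : Matrix m m ℂ :=
  Matrix.of fun i j => ∑ k, ρ (i, k) (j, k)

/-- Quantum mutual information `I(X;B) = H(X) + H(B) - H(XB)` of a bipartite state. -/
def mutualInfo {m n : Type*} [Fintype m] [Fintype n] [DecidableEq m] [DecidableEq n]
    (ρ : Matrix (m × n) (m × n) ℂ) : ℝ :=
  vonNeumannEntropy (traceSnd ρ) + vonNeumannEntropy (traceFst ρ) - vonNeumannEntropy ρ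

/-- The map `id ⊗ N` on `X ⊗ A`, i.e. `N` applied to each block of a block matrix. -/
def idTensor {a b : Type*} (X : Type*) (N : Matrix a a ℂ →ₗ[ℂ] Matrix b b ℂ)
    (ρ : Matrix (X × a) (X × a) ℂ) : Matrix (X × b) (X × b) ℂ :=
  Matrix.of fun i j => N (Matrix.of fun s t => ρ (i.1, s) (j.1, t)) i.2 j.2

/-- `N : A → B` and `Nc : A → E` are complementary channels: there is an isometry
`V : A → B ⊗ E` with `N ρ = tr_E (V ρ V†)` and `Nc ρ = tr_B (V ρ V†)`. -/
def IsComplementary {a b e : Type*} [Fintype a] [Fintype b] [Fintype e] [DecidableEq a]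
    (N : Matrix a a ℂ →ₗ[ℂ] Matrix b b ℂ) (Nc : Matrix a a ℂ →ₗ[ℂ] Matrix e e ℂ) : Prop :=
  ∃ V : Matrix (b × e) a ℂ, V.conjTranspose * V = 1 ∧
    (∀ ρ, N ρ = traceSnd (V * ρ * V.conjTranspose)) ∧
    (∀ ρ, Nc ρ = traceFst (V * ρ * V.conjTranspose))

/-- Classical-quantum states `∑ x, p_x |x⟩⟨x| ⊗ ρ_x` on `X ⊗ A`. -/
def IsCQState {X a : Type*} [Fintype X] [Fintype a] [DecidableEq X]
    (ρ : Matrix (X × a) (X × a) ℂ) : Prop :=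
  ∃ (p : X → ℝ) (σ : X → Matrix a a ℂ), (∀ x, 0 ≤ p x) ∧ ∑ x, p x = 1 ∧
    (∀ x, IsDensity (σ x)) ∧
    ρ = ∑ x, (p x : ℂ) • (Matrix.single x x (1 : ℂ) ⊗ₖ σ x)

/-- Positive operator valued measures with finite outcome set `Y`. -/
def IsPOVM {Y e : Type*} [Fintype Y] [Fintype e] [DecidableEq e]
    (Γ : Y → Matrix e e ℂ) : Prop :=
  (∀ y, (Γ y).PosSemidef) ∧ ∑ y, Γ y = 1

/-- Joint distribution of `X` (read in its standard basis) and the outcome `Y` of the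
measurement `Γ` of `E`: `P(x,y) = tr (ρ^{XE} (|x⟩⟨x| ⊗ Γ_y))`. -/
def outcomeDist {X Y e : Type*} [Fintype X] [Fintype e] [DecidableEq X]
    (ρ : Matrix (X × e) (X × e) ℂ) (Γ : Y → Matrix e e ℂ) : X × Y → ℝ :=
  fun z => (ρ * (Matrix.single z.1 z.1 (1 : ℂ) ⊗ₖ Γ z.2)).trace.re

/-- Accessible information `I_acc(X;E)`: the supremum of `I(X;Y)` over all measurements
(POVMs) of `E`. -/
def accessibleInfo {X e : Type*} [Fintype X] [Fintype e] [DecidableEq X] [DecidableEq e]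
    (ρ : Matrix (X × e) (X × e) ℂ) : EReal :=
  ⨆ (m : ℕ) (Γ : Fin m → Matrix e e ℂ) (_ : IsPOVM Γ),
    (shannonMutualInfo (outcomeDist ρ Γ) : EReal)

/-- Locking information of a channel `N : A → B`: the supremum of `I(X;B) - I_acc(X;E)` over
all classical-quantum input states on `X ⊗ A`, where `E` is the output of a complementary
channel. The complementary channel is unique up to an isometry on its output, which does not
change the accessible information, so that the supremum over it is over equal values. -/
def lockingInfo {a b : Type*} [Fintype a] [Fintype b] [DecidableEq a] [DecidableEq b]
    (N : Matrix a a ℂ →ₗ[ℂ] Matrix b b ℂ) : EReal :=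
  ⨆ (k : ℕ) (Nc : Matrix a a ℂ →ₗ[ℂ] Matrix (Fin k) (Fin k) ℂ) (_ : IsComplementary N Nc)
    (n : ℕ) (ρ : Matrix (Fin n × a) (Fin n × a) ℂ) (_ : IsCQState ρ),
    (mutualInfo (idTensor (Fin n) N ρ) : EReal) - accessibleInfo (idTensor (Fin n) Nc ρ)

/-- The erasure channel `ρ ↦ (1 - p) ρ + p (tr ρ) |e⟩⟨e|` from `ℂ^d` to `ℂ^d ⊕ ℂ e`, with an
erasure flag `e` orthogonal to the input space. -/
def erasureChannel (p : ℝ) (d : ℕ) :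
    Matrix (Fin d) (Fin d) ℂ →ₗ[ℂ] Matrix (Fin d ⊕ Unit) (Fin d ⊕ Unit) ℂ where
  toFun ρ := Matrix.fromBlocks (((1 - p : ℝ) : ℂ) • ρ) 0 0 (((p : ℂ) * ρ.trace) • 1)
  map_add' ρ σ := by
    rw [Matrix.fromBlocks_add, Matrix.trace_add, smul_add, mul_add, add_smul]
    simp only [add_zero]
  map_smul' c ρ := by
    simp only [RingHom.id_apply, Matrix.fromBlocks_smul, Matrix.trace_smul, smul_zero,
      smul_eq_mul, smul_smul]
    rw [mul_comm c ((1 - p : ℝ) : ℂ), mul_left_comm (p : ℂ)]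

/-- `γ_d = ln d - ∑_{t=2}^d 1/t`. -/
def gammaSeq (d : ℕ) : ℝ := Real.log d - ∑ t ∈ Finset.Icc 2 d, (1 : ℝ) / t

end

end QInfo

/-!
The environment of the erasure channel with erasure probability `p` receives the channel input with
probability `p`. Hence for an ensemble with Holevo quantity `χ` the channel output carries mutual
information `(1 - p) χ`, and any measurement of the input can be simulated on the environment so
as to extract `p` times its information. For an arbitrary complementary channel, this simulation
is read off from the Kraus operators: the one belonging to the erasure flag is `√p` times an
isometry whose range is orthogonal to the ranges of the others (`exists_effect_map`).

It remains to find a measurement of the input with information at least `χ - h`, where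
`h = ∑_{t=2}^d 1/t` in nats, because then the locking information is at most
`(1 - p) χ - p (χ - h) = (1 - 2p) χ + p h ≤ (1 - 2p) log d + p h`, which is the claimed bound. The
measurement consists of the rank-one effects `|z_g⟩⟨z_g| / d`, where `z_g` runs over the orbit of a
unit vector `z` under the `d²` Weyl-Heisenberg operators. By concavity of `-x log x`, its outcome
entropy at any state is at least `S + log d`; by subadditivity of `-x log x`, it is at most
`S + log d` plus the average over the eigenvectors `v` of `∑_g -|⟨v, z_g⟩|² log |⟨v, z_g⟩|² / d`.

That some `z` makes the total average of the last sum at most `h` follows by averaging over a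
complex Gaussian vector `x`, with `z = x / ‖x‖` and weight `‖x‖²`
(`exists_unit_vector_entropy_le`): by unitary invariance each term becomes a combination of
Gaussian integrals of `|x_i|² log |x_i|²` and `‖x‖² log ‖x‖²`. In polar coordinates these are the
derivative of the Gamma function at `2` and at `d + 1`, and their difference produces the harmonic
number.
-/

open scoped Kronecker ComplexOrder

namespace QInfo

section GaussianIntegrals

open MeasureTheory Real Set

/-! ### Radial Gaussian integrals and the derivative of the Gamma function -/

/-- This integral is the derivative of the Gamma function at `n + 1`. -/
theorem integral_pow_mul_log_mul_exp_neg (n : ℕ) :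
    ∫ t in Ioi (0 : ℝ), t ^ n * (log t * exp (-t)) =
      n.factorial * (-eulerMascheroniConstant + harmonic n) := by
  have h1 := Complex.hasDerivAt_GammaIntegral (s := (n : ℂ) + 1) (by simp; positivity)
  have h2 := Complex.hasDerivAt_Gamma_nat n
  have h3 : Complex.Gamma =ᶠ[nhds ((n : ℂ) + 1)] Complex.GammaIntegral := by
    have : {s : ℂ | 0 < s.re} ∈ nhds ((n : ℂ) + 1) :=
      (isOpen_lt continuous_const Complex.continuous_re).mem_nhds (by simp; positivity)
    filter_upwards [this] with s hs using Complex.Gamma_eq_integral hs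
  have h4 := (h1.congr_of_eventuallyEq h3).unique h2
  have h5 : ∫ t in Ioi (0 : ℝ), ((t : ℂ) ^ ((n : ℂ) + 1 - 1) * (Real.log t * Real.exp (-t))) =
      ((∫ t in Ioi (0 : ℝ), t ^ n * (log t * exp (-t)) : ℝ) : ℂ) := by
    rw [← integral_complex_ofReal]
    refine integral_congr_ae (Filter.Eventually.of_forall fun t => ?_)
    simp
  rw [h5] at h4
  exact_mod_cast h4

theorem one_le_harmonic {n : ℕ} (hn : 1 ≤ n) : (1 : ℝ) ≤ harmonic n := by
  have : (1 : ℚ) ≤ harmonic n := by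
    induction n, hn using Nat.le_induction with
    | base => simp [harmonic]
    | succ m _ ih => rw [harmonic_succ]; exact ih.trans (le_add_of_nonneg_right (by positivity))
  exact_mod_cast this

theorem integrableOn_pow_mul_log_mul_exp_neg {n : ℕ} (hn : 1 ≤ n) :
    IntegrableOn (fun t : ℝ => t ^ n * (log t * exp (-t))) (Ioi 0) := by
  -- the value of the integral is not zero, hence not the junk value of a divergent integral
  refine Integrable.of_integral_ne_zero ?_
  rw [integral_pow_mul_log_mul_exp_neg]
  have := one_le_harmonic hn
  have := eulerMascheroniConstant_lt_two_thirds
  exact mul_ne_zero (by positivity) (by linarith)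

section Radial

variable {E : Type*} [NormedAddCommGroup E] [NormedSpace ℝ E] [FiniteDimensional ℝ E]
  [MeasurableSpace E] [BorelSpace E] (μ : Measure E) [μ.IsAddHaarMeasure]

/-- The integrand of the polar coordinate formula in real dimension `2 * n`, in the form required
for the substitution `t = y ^ 2`. -/
theorem pow_smul_comp_sq {n : ℕ} (hn : 1 ≤ n) (g : ℝ → ℝ) (y : ℝ) :
    y ^ (2 * n - 1) • g (y ^ 2) =
      (1 / 2) * ((|(2 : ℝ)| * y ^ ((2 : ℝ) - 1)) • ((fun t => t ^ (n - 1) * g t) (y ^ (2 : ℝ)))) := by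
  obtain ⟨m, rfl⟩ := Nat.exists_eq_add_of_le' hn
  have h1 : y ^ ((2 : ℝ) - 1) = y := by norm_num
  have h2 : 2 * (m + 1) - 1 = 2 * m + 1 := by lia
  rw [h1, h2, Real.rpow_two, abs_of_pos two_pos]
  simp only [smul_eq_mul, Nat.add_sub_cancel]
  ring

theorem integral_comp_norm_sq {n : ℕ} (hn : 1 ≤ n) (hE : Module.finrank ℝ E = 2 * n)
    (g : ℝ → ℝ) :
    ∫ x, g (‖x‖ ^ 2) ∂μ =
      n * μ.real (Metric.ball 0 1) * ∫ t in Ioi (0 : ℝ), t ^ (n - 1) * g t := by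
  have : Nontrivial E := Module.nontrivial_of_finrank_pos (R := ℝ) (by lia)
  rw [integral_fun_norm_addHaar μ (fun y => g (y ^ 2)), hE,
    setIntegral_congr_fun measurableSet_Ioi (fun y _ => pow_smul_comp_sq hn g y),
    integral_const_mul, integral_comp_rpow_Ioi (fun t => t ^ (n - 1) * g t) two_ne_zero]
  simp only [smul_eq_mul, nsmul_eq_mul]
  push_cast
  ring

theorem integrable_comp_norm_sq {n : ℕ} (hn : 1 ≤ n) (hE : Module.finrank ℝ E = 2 * n)
    {g : ℝ → ℝ} (hg : IntegrableOn (fun t => t ^ (n - 1) * g t) (Ioi 0)) :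
    Integrable (fun x => g (‖x‖ ^ 2)) μ := by
  have : Nontrivial E := Module.nontrivial_of_finrank_pos (R := ℝ) (by lia)
  rw [integrable_fun_norm_addHaar μ (f := fun y => g (y ^ 2)), hE,
    integrableOn_congr_fun (fun y _ => pow_smul_comp_sq hn g y) measurableSet_Ioi]
  exact ((integrableOn_Ioi_comp_rpow_iff _ two_ne_zero).2 hg).const_mul _

theorem integrable_normSq_mul_log {n : ℕ} (hn : 1 ≤ n) (hE : Module.finrank ℝ E = 2 * n) :
    Integrable (fun x : E => ‖x‖ ^ 2 * log (‖x‖ ^ 2) * exp (-‖x‖ ^ 2)) μ := by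
  refine integrable_comp_norm_sq μ hn hE (g := fun t => t * log t * exp (-t)) ?_
  refine (integrableOn_pow_mul_log_mul_exp_neg hn).congr_fun (fun t _ => ?_) measurableSet_Ioi
  obtain ⟨m, rfl⟩ := Nat.exists_eq_add_of_le' hn
  simp only [Nat.add_sub_cancel]
  ring

theorem integrable_normSq {n : ℕ} (hn : 1 ≤ n) (hE : Module.finrank ℝ E = 2 * n) :
    Integrable (fun x : E => ‖x‖ ^ 2 * exp (-‖x‖ ^ 2)) μ := by
  refine integrable_comp_norm_sq μ hn hE (g := fun t => t * exp (-t)) ?_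
  refine (Real.GammaIntegral_convergent (s := n + 1) (by positivity)).congr_fun (fun t _ => ?_)
    measurableSet_Ioi
  obtain ⟨m, rfl⟩ := Nat.exists_eq_add_of_le' hn
  simp only [Nat.add_sub_cancel, add_sub_cancel_right, Real.rpow_natCast]
  ring

/-- Under the Gaussian weight in real dimension `2 * n`, the squared norm has the Gamma distribution
of shape `n`. -/
theorem integral_normSq_mul_log {n : ℕ} (hn : 1 ≤ n) (hE : Module.finrank ℝ E = 2 * n) :
    ∫ x, ‖x‖ ^ 2 * log (‖x‖ ^ 2) * exp (-‖x‖ ^ 2) ∂μ =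
      (-eulerMascheroniConstant + harmonic n) * ∫ x, ‖x‖ ^ 2 * exp (-‖x‖ ^ 2) ∂μ := by
  obtain ⟨m, rfl⟩ := Nat.exists_eq_add_of_le' hn
  rw [integral_comp_norm_sq μ hn hE (fun t => t * log t * exp (-t)),
    integral_comp_norm_sq μ hn hE (fun t => t * exp (-t))]
  have h1 : ∫ t in Ioi (0 : ℝ), t ^ (m + 1 - 1) * (t * log t * exp (-t)) =
      ∫ t in Ioi (0 : ℝ), t ^ (m + 1) * (log t * exp (-t)) := by
    congr 1; ext t; simp only [Nat.add_sub_cancel]; ring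
  have h2 : ∫ t in Ioi (0 : ℝ), t ^ (m + 1 - 1) * (t * exp (-t)) = (m + 1).factorial := by
    rw [← Real.Gamma_nat_eq_factorial, Real.Gamma_eq_integral (by positivity)]
    congr 1; ext t
    simp only [Nat.add_sub_cancel, add_sub_cancel_right, Real.rpow_natCast]
    ring
  rw [h1, h2, integral_pow_mul_log_mul_exp_neg]
  ring

/-- A linear isometry preserves every Haar measure, since it preserves the unit ball. -/
theorem measurePreserving_of_isometry (T : E ≃ₗᵢ[ℝ] E) : MeasurePreserving T μ μ := by
  refine ⟨T.continuous.measurable, ?_⟩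
  have h : (μ.map T).IsAddHaarMeasure :=
    T.toContinuousLinearEquiv.isAddHaarMeasure_map μ
  have h1 := Measure.isAddLeftInvariant_eq_smul (μ.map T) μ
  have h2 : μ.map T (Metric.ball 0 1) = μ (Metric.ball 0 1) := by
    rw [Measure.map_apply T.continuous.measurable Metric.isOpen_ball.measurableSet]
    congr 1
    ext x
    simp
  rw [h1] at h2 ⊢
  rw [Measure.smul_apply] at h2
  have h3 := (ENNReal.mul_left_inj (Metric.measure_ball_pos μ 0 one_pos).ne'
    measure_ball_lt_top.ne).1 ((show _ from h2).trans (one_mul _).symm)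
  have h4 : Measure.addHaarScalarFactor (μ.map T) μ = 1 := by exact_mod_cast h3
  rw [h4, one_smul]

end Radial

/-! ### Outcome entropy of a random vector -/

section Gaussian

variable {ι : Type*} [Fintype ι]

/-- Lebesgue measure on `ℂ^ι`, carried over to the Hermitian space `EuclideanSpace ℂ ι`. -/
noncomputable def euclideanVolume (ι : Type*) [Fintype ι] : Measure (EuclideanSpace ℂ ι) :=
  (volume : Measure (ι → ℂ)).map (MeasurableEquiv.toLp 2 (ι → ℂ))

instance : (euclideanVolume ι).IsAddHaarMeasure :=
  (PiLp.continuousLinearEquiv 2 ℝ (fun _ : ι => ℂ)).symm.isAddHaarMeasure_map volume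

theorem finrank_real_euclideanSpace :
    Module.finrank ℝ (EuclideanSpace ℂ ι) = 2 * Fintype.card ι := by
  rw [finrank_real_of_complex, finrank_euclideanSpace]

theorem apply_mul_exp_eq_prod [DecidableEq ι] (f : ℂ → ℝ) (i : ι) (z : ι → ℂ) :
    f (z i) * exp (-‖(WithLp.toLp 2 z : EuclideanSpace ℂ ι)‖ ^ 2) =
      ∏ j, (fun w : ℂ => (if j = i then f w else 1) * exp (-‖w‖ ^ 2)) (z j) := by
  have h : -‖(WithLp.toLp 2 z : EuclideanSpace ℂ ι)‖ ^ 2 = ∑ j, -‖z j‖ ^ 2 := by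
    rw [EuclideanSpace.norm_sq_eq, Finset.sum_neg_distrib]
  rw [h, exp_sum, Finset.prod_mul_distrib]
  simp

theorem integrable_coord {f : ℂ → ℝ} (hf : Integrable fun w => f w * exp (-‖w‖ ^ 2)) (i : ι)
    (h1 : Integrable fun w : ℂ => exp (-‖w‖ ^ 2)) :
    Integrable (fun x => f (x i) * exp (-‖x‖ ^ 2)) (euclideanVolume ι) := by
  classical
  rw [euclideanVolume, (MeasurableEquiv.toLp 2 (ι → ℂ)).measurableEmbedding.integrable_map_iff]
  have : ∀ j, Integrable (fun w : ℂ => (if j = i then f w else 1) * exp (-‖w‖ ^ 2)) := by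
    intro j
    by_cases h : j = i
    · simpa [h] using hf
    · simpa [h] using h1
  refine (Integrable.fintype_prod this).congr (Filter.Eventually.of_forall fun z => ?_)
  exact (apply_mul_exp_eq_prod f i z).symm

/-- The `i`-th coordinate of a complex Gaussian vector is a complex Gaussian. -/
theorem integral_coord (f : ℂ → ℝ) (i : ι) :
    ∫ x, f (x i) * exp (-‖x‖ ^ 2) ∂(euclideanVolume ι) =
      (∫ w : ℂ, exp (-‖w‖ ^ 2)) ^ (Fintype.card ι - 1) * ∫ w, f w * exp (-‖w‖ ^ 2) := by
  classical
  rw [euclideanVolume, integral_map_equiv]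
  have := integral_fintype_prod_volume_eq_prod (𝕜 := ℝ)
    (fun (j : ι) (w : ℂ) => (if j = i then f w else 1) * exp (-‖w‖ ^ 2))
  simp only [MeasurableEquiv.coe_toLp, apply_mul_exp_eq_prod f i, this]
  rw [← Finset.mul_prod_erase _ _ (Finset.mem_univ i), mul_comm,
    Finset.prod_congr rfl (g := fun _ => ∫ w : ℂ, exp (-‖w‖ ^ 2))
      (fun j hj => by simp [(Finset.mem_erase.1 hj).1])]
  simp [Finset.card_erase_of_mem]

/-- The unitary is given by an orthonormal basis extending `v`. -/
theorem exists_isometry_apply_eq_inner {v : EuclideanSpace ℂ ι} (hv : ‖v‖ = 1) (i : ι) :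
    ∃ T : EuclideanSpace ℂ ι ≃ₗᵢ[ℝ] EuclideanSpace ℂ ι, ∀ x, T x i = inner ℂ v x := by
  have hs : Orthonormal ℂ (({i} : Set ι).domRestrict fun _ => v) := by
    constructor
    · exact fun _ => hv
    · intro j k hjk; exact absurd (Subsingleton.elim j k) hjk
  obtain ⟨b, hb⟩ := hs.exists_orthonormalBasis_extension_of_card_eq (by simp)
  refine ⟨⟨b.repr.toLinearEquiv.restrictScalars ℝ, b.repr.norm_map⟩, fun x => ?_⟩
  rw [← hb i rfl]
  exact b.repr_apply_apply x i

/-- Unitary invariance: the inner product with a unit vector has, jointly with the norm, the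
distribution of a coordinate. -/
theorem integral_comp_inner {v : EuclideanSpace ℂ ι} (hv : ‖v‖ = 1) (i : ι) (G : ℂ → ℝ → ℝ) :
    ∫ x, G (inner ℂ v x) ‖x‖ ∂(euclideanVolume ι) =
      ∫ x, G (x i) ‖x‖ ∂(euclideanVolume ι) := by
  obtain ⟨T, hT⟩ := exists_isometry_apply_eq_inner hv i
  have := (measurePreserving_of_isometry (euclideanVolume ι) T).integral_comp
    T.toHomeomorph.measurableEmbedding (fun x => G (x i) ‖x‖)
  simpa only [hT, LinearIsometryEquiv.norm_map] using this

theorem integrable_comp_inner {v : EuclideanSpace ℂ ι} (hv : ‖v‖ = 1) (i : ι) {G : ℂ → ℝ → ℝ}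
    (hG : Integrable (fun x => G (x i) ‖x‖) (euclideanVolume ι)) :
    Integrable (fun x => G (inner ℂ v x) ‖x‖) (euclideanVolume ι) := by
  obtain ⟨T, hT⟩ := exists_isometry_apply_eq_inner hv i
  have := (measurePreserving_of_isometry (euclideanVolume ι) T).integrable_comp_emb
    T.toHomeomorph.measurableEmbedding (g := fun x => G (x i) ‖x‖)
  simpa only [Function.comp_def, hT, LinearIsometryEquiv.norm_map] using this.2 hG

theorem integral_coord_eq (i j : ι) (G : ℂ → ℝ → ℝ) :
    ∫ x, G (x i) ‖x‖ ∂(euclideanVolume ι) = ∫ x, G (x j) ‖x‖ ∂(euclideanVolume ι) := by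
  classical
  have h := integral_comp_inner (v := EuclideanSpace.single i (1 : ℂ)) (by simp) j G
  simpa [EuclideanSpace.inner_single_left] using h

theorem norm_coord_sq_le (x : EuclideanSpace ℂ ι) (i : ι) : ‖x i‖ ^ 2 ≤ ‖x‖ ^ 2 := by
  rw [EuclideanSpace.norm_sq_eq]
  exact Finset.single_le_sum (f := fun i => ‖x i‖ ^ 2) (fun _ _ => by positivity)
    (Finset.mem_univ i)

theorem integrable_coord_sq_mul (i : ι) {g : ℝ → ℝ} (hg : Measurable g)
    (h : Integrable (fun x => ‖x‖ ^ 2 * g ‖x‖) (euclideanVolume ι)) :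
    Integrable (fun x => ‖x i‖ ^ 2 * g ‖x‖) (euclideanVolume ι) := by
  refine h.mono (by fun_prop) (Filter.Eventually.of_forall fun x => ?_)
  rw [norm_mul, norm_mul, Real.norm_of_nonneg (sq_nonneg ‖x i‖),
    Real.norm_of_nonneg (sq_nonneg ‖x‖)]
  exact mul_le_mul_of_nonneg_right (norm_coord_sq_le x i) (norm_nonneg _)

theorem integral_coord_sq_mul (i : ι) {g : ℝ → ℝ} (hg : Measurable g)
    (h : Integrable (fun x => ‖x‖ ^ 2 * g ‖x‖) (euclideanVolume ι)) :
    Fintype.card ι * ∫ x, ‖x i‖ ^ 2 * g ‖x‖ ∂(euclideanVolume ι) =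
      ∫ x, ‖x‖ ^ 2 * g ‖x‖ ∂(euclideanVolume ι) := by
  have h1 : ∀ x : EuclideanSpace ℂ ι, ‖x‖ ^ 2 * g ‖x‖ = ∑ j, ‖x j‖ ^ 2 * g ‖x‖ := fun x => by
    rw [EuclideanSpace.norm_sq_eq, Finset.sum_mul]
  simp_rw [h1]
  rw [integral_finsetSum _ fun j _ => integrable_coord_sq_mul j hg h,
    Finset.sum_congr rfl fun j _ => integral_coord_eq j i (fun w r => ‖w‖ ^ 2 * g r)]
  simp

theorem mul_negMulLog_div (r s : ℝ) (h : s ≠ 0) :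
    s * negMulLog (r / s) = r * log s - r * log r := by
  rcases eq_or_ne r 0 with rfl | hr
  · simp
  · rw [negMulLog, log_div hr h]; field_simp; ring

/-- Splits the weighted entropy contribution into a part that involves the norm only through
`‖x‖ ^ 2 * log (‖x‖ ^ 2)` and a part that depends on a single coordinate. -/
theorem weighted_negMulLog_eq (v x : EuclideanSpace ℂ ι) :
    ‖x‖ ^ 2 * negMulLog (‖inner ℂ v x‖ ^ 2 / ‖x‖ ^ 2) * exp (-‖x‖ ^ 2) =
      ‖inner ℂ v x‖ ^ 2 * (log (‖x‖ ^ 2) * exp (-‖x‖ ^ 2)) -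
        ‖inner ℂ v x‖ ^ 2 * log (‖inner ℂ v x‖ ^ 2) * exp (-‖x‖ ^ 2) := by
  rcases eq_or_ne x 0 with rfl | hx
  · simp
  · rw [mul_negMulLog_div _ _ (by positivity)]; ring

theorem integrable_exp_neg_normSq : Integrable fun w : ℂ => exp (-‖w‖ ^ 2) := by
  have hE : Module.finrank ℝ ℂ = 2 * 1 := by simp
  refine integrable_comp_norm_sq volume le_rfl hE (g := fun t => exp (-t)) ?_
  simpa using (Real.GammaIntegral_convergent (s := 1) one_pos)

variable [Nonempty ι]

/-- One component of a random unit vector contributes on average `(harmonic d - 1) / d` to the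
entropy. The average is over the normalization of a Gaussian vector `x`, weighted by `‖x‖ ^ 2`. -/
theorem integrable_and_integral_weighted_negMulLog {v : EuclideanSpace ℂ ι} (hv : ‖v‖ = 1) :
    Integrable (fun x => ‖x‖ ^ 2 * negMulLog (‖inner ℂ v x‖ ^ 2 / ‖x‖ ^ 2) * exp (-‖x‖ ^ 2))
        (euclideanVolume ι) ∧
      ∫ x, ‖x‖ ^ 2 * negMulLog (‖inner ℂ v x‖ ^ 2 / ‖x‖ ^ 2) * exp (-‖x‖ ^ 2)
        ∂(euclideanVolume ι) = (harmonic (Fintype.card ι) - 1) / Fintype.card ι *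
          ∫ x, ‖x‖ ^ 2 * exp (-‖x‖ ^ 2) ∂(euclideanVolume ι) := by
  obtain ⟨i⟩ := ‹Nonempty ι›
  have hn : 1 ≤ Fintype.card ι := Fintype.card_pos_iff.2 ⟨i⟩
  have hE := finrank_real_euclideanSpace (ι := ι)
  have hC : Module.finrank ℝ ℂ = 2 * 1 := by simp
  have hL := integrable_normSq_mul_log (euclideanVolume ι) hn hE
  have hLv := integral_normSq_mul_log (euclideanVolume ι) hn hE
  simp only [mul_assoc] at hL hLv
  have hg : Measurable fun r : ℝ => log (r ^ 2) * exp (-r ^ 2) := by fun_prop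
  have hN := integrable_normSq (euclideanVolume ι) hn hE
  have hg' : Measurable fun r : ℝ => exp (-r ^ 2) := by fun_prop
  have a1 := integrable_coord_sq_mul i hg hL
  have a2 := integral_coord_sq_mul i hg hL
  have a3 := integral_coord_sq_mul i hg' hN
  have b1 := integrable_coord (integrable_normSq_mul_log (volume : Measure ℂ) le_rfl hC) i
    integrable_exp_neg_normSq
  have b2 := integral_coord (fun w => ‖w‖ ^ 2 * log (‖w‖ ^ 2)) i
  rw [integral_normSq_mul_log (volume : Measure ℂ) le_rfl hC, mul_left_comm,
    ← integral_coord (fun w => ‖w‖ ^ 2) i] at b2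
  have c1 := integrable_comp_inner hv i (G := fun w r => ‖w‖ ^ 2 * (log (r ^ 2) * exp (-r ^ 2))) a1
  have c2 := integral_comp_inner hv i (G := fun w r => ‖w‖ ^ 2 * (log (r ^ 2) * exp (-r ^ 2)))
  have d1 := integrable_comp_inner hv i
    (G := fun w r => ‖w‖ ^ 2 * log (‖w‖ ^ 2) * exp (-r ^ 2)) b1
  have d2 := integral_comp_inner hv i
    (G := fun w r => ‖w‖ ^ 2 * log (‖w‖ ^ 2) * exp (-r ^ 2))
  simp_rw [weighted_negMulLog_eq]
  refine ⟨c1.sub d1, ?_⟩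
  rw [integral_sub c1 d1, c2, d2, b2]
  rw [hLv, ← a3] at a2
  have hd : (Fintype.card ι : ℝ) ≠ 0 := by positivity
  rw [← a3, ← mul_right_inj' hd, mul_sub, a2]
  simp only [harmonic_succ, harmonic_zero]
  push_cast
  field_simp
  ring

/-- Some unit vector does at least as well as the average over all unit vectors. -/
theorem exists_unit_vector_entropy_le {κ : Type*} [Fintype κ] (c : κ → ℝ)
    (u : κ → EuclideanSpace ℂ ι) (hu : ∀ k, ‖u k‖ = 1) :
    ∃ z : EuclideanSpace ℂ ι, ‖z‖ = 1 ∧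
      ∑ k, c k * negMulLog (‖inner ℂ (u k) z‖ ^ 2) ≤
        (∑ k, c k) * ((harmonic (Fintype.card ι) - 1) / Fintype.card ι) := by
  by_contra! hcon
  set h : ℝ := (harmonic (Fintype.card ι) - 1) / Fintype.card ι
  set F : κ → EuclideanSpace ℂ ι → ℝ := fun k x =>
    ‖x‖ ^ 2 * negMulLog (‖inner ℂ (u k) x‖ ^ 2 / ‖x‖ ^ 2) * exp (-‖x‖ ^ 2)
  -- `D` has integral zero, but would be positive away from the origin
  set D : EuclideanSpace ℂ ι → ℝ := fun x =>
    ∑ k, c k * F k x - ((∑ k, c k) * h) * (‖x‖ ^ 2 * exp (-‖x‖ ^ 2))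
  have hn : 1 ≤ Fintype.card ι := Fintype.card_pos
  have hN := integrable_normSq (euclideanVolume ι) hn finrank_real_euclideanSpace
  have hF : ∀ k, Integrable (F k) (euclideanVolume ι) := fun k =>
    (integrable_and_integral_weighted_negMulLog (hu k)).1
  have hS : Integrable (fun x => ∑ k, c k * F k x) (euclideanVolume ι) :=
    integrable_finsetSum _ fun k _ => (hF k).const_mul _
  have hD : Integrable D (euclideanVolume ι) := hS.sub (hN.const_mul _)
  have hint : ∫ x, D x ∂(euclideanVolume ι) = 0 := by
    simp only [D]
    rw [integral_sub hS (hN.const_mul _), integral_finsetSum _ fun k _ => (hF k).const_mul _,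
      integral_const_mul]
    simp only [integral_const_mul, F, (integrable_and_integral_weighted_negMulLog (hu _)).2]
    rw [← Finset.sum_mul]
    ring
  have hpos : ∀ x, x ≠ 0 → 0 < D x := by
    intro x hx
    have hx' : 0 < ‖x‖ := norm_pos_iff.2 hx
    have h1 := hcon (((‖x‖⁻¹ : ℝ) : ℂ) • x) (by
      rw [norm_smul, Complex.norm_real, norm_inv, norm_norm, inv_mul_cancel₀ hx'.ne'])
    have h2 : ∀ k, ‖inner ℂ (u k) (((‖x‖⁻¹ : ℝ) : ℂ) • x)‖ ^ 2 =
        ‖inner ℂ (u k) x‖ ^ 2 / ‖x‖ ^ 2 := fun k => by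
      rw [inner_smul_right, norm_mul, Complex.norm_real, norm_inv, norm_norm]
      field_simp
    simp only [h2] at h1
    have h3 : D x = (∑ k, c k * negMulLog (‖inner ℂ (u k) x‖ ^ 2 / ‖x‖ ^ 2) - (∑ k, c k) * h) *
        (‖x‖ ^ 2 * exp (-‖x‖ ^ 2)) := by
      simp only [D, F]
      rw [sub_mul]
      congr 1
      rw [Finset.sum_mul]
      refine Finset.sum_congr rfl fun k _ => ?_
      ring
    rw [h3]
    exact mul_pos (sub_pos.2 h1) (by positivity)
  have hD0 : D 0 = 0 := by simp [D, F]
  have hnonneg : 0 ≤ D := fun x => by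
    rcases eq_or_ne x 0 with rfl | hx
    · exact hD0.ge
    · exact (hpos x hx).le
  have hae := (integral_eq_zero_iff_of_nonneg hnonneg hD).1 hint
  have hsub : Metric.ball (0 : EuclideanSpace ℂ ι) 1 \ {0} ⊆
      {x | ¬ D x = (0 : EuclideanSpace ℂ ι → ℝ) x} :=
    fun x hx => (hpos x hx.2).ne'
  have hnull := measure_mono_null hsub hae
  have : Nontrivial (EuclideanSpace ℂ ι) :=
    Module.nontrivial_of_finrank_pos (R := ℝ) (by rw [finrank_real_euclideanSpace]; lia)
  rw [measure_sdiff_null (measure_singleton _)] at hnull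
  exact (Metric.measure_ball_pos (euclideanVolume ι) 0 one_pos).ne' hnull

end Gaussian

end GaussianIntegrals

open Real Matrix

/-! ### Entropies, spectra and the output of the erasure channel -/

theorem shannonEntropy_eq_sum_negMulLog {ι : Type*} [Fintype ι] (q : ι → ℝ) :
    shannonEntropy q = (∑ i, negMulLog (q i)) / log 2 := by
  rw [shannonEntropy, Finset.sum_div]
  refine Finset.sum_congr rfl fun i _ => ?_
  rw [negMulLog, logb]
  ring

theorem shannonEntropy_comp_equiv {ι κ : Type*} [Fintype ι] [Fintype κ] (e : κ ≃ ι) (q : ι → ℝ) :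
    shannonEntropy (fun k => q (e k)) = shannonEntropy q :=
  e.sum_comp fun i => -(q i * logb 2 (q i))

/-- Erasure multiplies a Holevo-type quantity by the probability `c` of transmission: each weight
distribution `r x` is scaled by `c` and completed by an erasure event of probability `1 - c`. The
same identity serves for quantum outputs, with `r x` and `m` the spectra, and for measurement
outcomes. -/
theorem entropy_identity_of_erasure {ι κ : Type*} [Fintype ι] [Fintype κ] (c : ℝ) {w : ι → ℝ}
    (hw : ∑ x, w x = 1) {r : ι → κ → ℝ} (hr : ∀ x, ∑ i, r x i = 1) {m : κ → ℝ}
    (hm : ∑ i, m i = 1) :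
    ∑ x, negMulLog (w x) + (∑ i, negMulLog (c * m i) + negMulLog (1 - c)) -
        ∑ x, (∑ i, negMulLog (w x * (c * r x i)) + negMulLog (w x * (1 - c))) =
      c * (∑ i, negMulLog (m i) - ∑ x, w x * ∑ i, negMulLog (r x i)) := by
  have h1 : ∀ x, ∑ i, negMulLog (w x * (c * r x i)) + negMulLog (w x * (1 - c)) =
      negMulLog (w x) + w x * (negMulLog c + negMulLog (1 - c)) +
        c * (w x * ∑ i, negMulLog (r x i)) := by
    intro x
    simp only [negMulLog_mul, mul_add, Finset.sum_add_distrib, ← Finset.mul_sum, ← Finset.sum_mul,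
      hr]
    ring
  have h2 : ∑ i, negMulLog (c * m i) = negMulLog c + c * ∑ i, negMulLog (m i) := by
    simp only [negMulLog_mul, Finset.sum_add_distrib, ← Finset.mul_sum, ← Finset.sum_mul, hm]
    ring
  rw [h2, Finset.sum_congr rfl fun x _ => h1 x, Finset.sum_add_distrib, Finset.sum_add_distrib,
    ← Finset.sum_mul, hw, ← Finset.mul_sum]
  ring

/-- `M` is Hermitian and `a` lists its eigenvalues with multiplicity, in any order and over any
index type. -/
def HasSpectrum {n ι : Type*} [Fintype n] [DecidableEq n] [Fintype ι] (M : Matrix n n ℂ)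
    (a : ι → ℝ) : Prop :=
  M.IsHermitian ∧ M.charpoly = ∏ i, (Polynomial.X - Polynomial.C (a i : ℂ))

section Spectrum

variable {m n ι κ : Type*} [Fintype m] [Fintype n] [Fintype ι] [Fintype κ]
  [DecidableEq m] [DecidableEq n]

theorem HasSpectrum.vonNeumannEntropy {M : Matrix n n ℂ} {a : ι → ℝ} (h : HasSpectrum M a) :
    vonNeumannEntropy M = (∑ i, negMulLog (a i)) / log 2 := by
  rw [QInfo.vonNeumannEntropy, dif_pos h.1, shannonEntropy_eq_sum_negMulLog]
  congr 1
  have h1 : M.charpoly.roots = Finset.univ.val.map fun i => (a i : ℂ) := by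
    rw [h.2, Polynomial.roots_prod _ _ (Finset.prod_ne_zero_iff.2 fun i _ =>
      Polynomial.X_sub_C_ne_zero _)]
    simp
  have h2 := congrArg (fun s => (s.map fun z : ℂ => negMulLog z.re).sum)
    (h.1.roots_charpoly_eq_eigenvalues.symm.trans h1)
  simpa [Multiset.map_map] using h2

theorem hasSpectrum_diagonal [DecidableEq ι] (a : ι → ℝ) :
    HasSpectrum (diagonal fun i => (a i : ℂ)) a :=
  ⟨isHermitian_diagonal_of_self_adjoint _ (by ext i; simp), charpoly_diagonal _⟩

theorem _root_.Matrix.IsHermitian.hasSpectrum_smul {M : Matrix n n ℂ} (h : M.IsHermitian) (c : ℝ) :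
    HasSpectrum ((c : ℂ) • M) (fun i => c * h.eigenvalues i) := by
  refine ⟨?_, ?_⟩
  · rw [IsHermitian, conjTranspose_smul, h.eq]; simp
  · conv_lhs => rw [h.spectral_theorem, Unitary.conjStarAlgAut_apply, ← smul_mul_assoc,
      ← mul_smul_comm, charpoly_mul_comm, ← mul_assoc]
    simp [← diagonal_smul, charpoly_diagonal]

theorem HasSpectrum.fromBlocks {A : Matrix m m ℂ} {B : Matrix n n ℂ} {a : ι → ℝ} {b : κ → ℝ}
    (hA : HasSpectrum A a) (hB : HasSpectrum B b) :
    HasSpectrum (fromBlocks A 0 0 B) (Sum.elim a b) := by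
  refine ⟨hA.1.fromBlocks (by simp) hB.1, ?_⟩
  rw [charpoly_fromBlocks_zero₁₂, hA.2, hB.2, Fintype.prod_sum_type]
  rfl

theorem charpoly_blockDiagonal (A : m → Matrix n n ℂ) :
    (blockDiagonal A).charpoly = ∏ x, (A x).charpoly := by
  simp only [charpoly]
  rw [← det_blockDiagonal]
  congr 1
  ext ⟨i, x⟩ ⟨j, y⟩ : 2
  simp only [charmatrix_apply, blockDiagonal_apply, diagonal_apply, Prod.mk.injEq]
  by_cases hxy : x = y <;> by_cases hij : i = j <;> simp [hxy, hij]

theorem HasSpectrum.blockDiagonal {A : m → Matrix n n ℂ} {a : m → ι → ℝ}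
    (h : ∀ x, HasSpectrum (A x) (a x)) :
    HasSpectrum ((Matrix.blockDiagonal A).submatrix Prod.swap Prod.swap)
      (fun i : m × ι => a i.1 i.2) := by
  constructor
  · apply IsHermitian.submatrix
    rw [IsHermitian, blockDiagonal_conjTranspose]
    congr 1
    ext1 x
    exact (h x).1
  · have := charpoly_reindex (Equiv.prodComm n m) (Matrix.blockDiagonal A)
    rw [reindex_apply] at this
    refine (show _ from this).trans ?_
    rw [charpoly_blockDiagonal, Fintype.prod_prod_type]
    exact Finset.prod_congr rfl fun x _ => (h x).2

end Spectrum

section ClassicalQuantum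

variable {X a b : Type*}

theorem cq_apply [Fintype X] [DecidableEq X] (w : X → ℝ) (σ : X → Matrix a a ℂ) (x y : X) (s t : a) :
    (∑ x, (w x : ℂ) • (Matrix.single x x (1 : ℂ) ⊗ₖ σ x)) (x, s) (y, t) =
      if x = y then (w x : ℂ) * σ x s t else 0 := by
  rw [Matrix.sum_apply]
  simp only [Matrix.smul_apply, kroneckerMap_apply, Matrix.single_apply, smul_eq_mul]
  split_ifs with h
  · subst h
    rw [Finset.sum_eq_single x]
    · simp
    · intro z _ hz; simp [hz]
    · simp
  · refine Finset.sum_eq_zero fun z _ => ?_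
    rw [if_neg (by rintro ⟨rfl, rfl⟩; exact h rfl)]
    simp

/-- A channel maps a classical-quantum state to a block diagonal matrix. Mathlib's block diagonal
matrices carry the block index second, whence the swap. -/
theorem idTensor_cq [Fintype X] [DecidableEq X] (N : Matrix a a ℂ →ₗ[ℂ] Matrix b b ℂ)
    (w : X → ℝ) (σ : X → Matrix a a ℂ) :
    idTensor X N (∑ x, (w x : ℂ) • (Matrix.single x x (1 : ℂ) ⊗ₖ σ x)) =
      (blockDiagonal fun x => (w x : ℂ) • N (σ x)).submatrix Prod.swap Prod.swap := by
  ext ⟨x, s⟩ ⟨y, t⟩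
  simp only [idTensor, of_apply, cq_apply, submatrix_apply, Prod.swap, blockDiagonal_apply]
  split_ifs with h
  · rw [show (of fun s t => (w x : ℂ) * σ x s t) = (w x : ℂ) • σ x from rfl, map_smul]
  · rw [show (of fun _ _ => (0 : ℂ)) = (0 : Matrix a a ℂ) from rfl, map_zero]
    rfl

theorem traceSnd_cq [DecidableEq X] [Fintype b] (w : X → ℝ) (τ : X → Matrix b b ℂ)
    (hτ : ∀ x, (τ x).trace = 1) :
    traceSnd ((blockDiagonal fun x => (w x : ℂ) • τ x).submatrix Prod.swap Prod.swap) =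
      diagonal fun x => (w x : ℂ) := by
  ext x y
  simp only [traceSnd, of_apply, submatrix_apply, Prod.swap, blockDiagonal_apply, diagonal_apply]
  split_ifs with h
  · have := hτ x
    rw [trace] at this
    simp only [diag_apply] at this
    simp [← Finset.mul_sum, this]
  · simp

theorem traceFst_cq [Fintype X] [DecidableEq X] (w : X → ℝ) (τ : X → Matrix b b ℂ) :
    traceFst ((blockDiagonal fun x => (w x : ℂ) • τ x).submatrix Prod.swap Prod.swap) =
      ∑ x, (w x : ℂ) • τ x := by
  ext s t
  simp [traceFst, Matrix.sum_apply]

/-- The average state of an ensemble of density matrices is a density matrix. -/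
theorem isDensity_average [Fintype X] [Fintype a] {w : X → ℝ} (hw0 : ∀ x, 0 ≤ w x)
    (hw : ∑ x, w x = 1) {σ : X → Matrix a a ℂ} (hσ : ∀ x, IsDensity (σ x)) : IsDensity (∑ x, (w x : ℂ) • σ x) := by
  constructor
  · exact posSemidef_sum _ fun x _ => (hσ x).1.smul (by exact_mod_cast hw0 x)
  · simp only [trace_sum, trace_smul, (hσ _).2, smul_eq_mul, mul_one]
    exact_mod_cast hw

end ClassicalQuantum

section Erasure

variable {d : ℕ} (p : ℝ)

theorem erasureChannel_apply (σ : Matrix (Fin d) (Fin d) ℂ) :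
    erasureChannel p d σ =
      Matrix.fromBlocks (((1 - p : ℝ) : ℂ) • σ) 0 0 (((p : ℂ) * σ.trace) • 1) := rfl

theorem IsDensity.sum_eigenvalues {n : Type*} [Fintype n] [DecidableEq n] {σ : Matrix n n ℂ}
    (hσ : IsDensity σ) : ∑ i, hσ.1.1.eigenvalues i = 1 := by
  have h := hσ.1.1.trace_eq_sum_eigenvalues.symm.trans hσ.2
  exact Complex.ofReal_injective (by simpa using h)

theorem hasSpectrum_erasureChannel {σ : Matrix (Fin d) (Fin d) ℂ} (hσ : IsDensity σ) (w : ℝ) :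
    HasSpectrum ((w : ℂ) • erasureChannel p d σ)
      (Sum.elim (fun i => w * ((1 - p) * hσ.1.1.eigenvalues i)) fun _ : Unit => w * p) := by
  have h : (w : ℂ) • erasureChannel p d σ =
      Matrix.fromBlocks (((w * (1 - p) : ℝ) : ℂ) • σ) 0 0 (((w * p : ℝ) : ℂ) • 1) := by
    rw [erasureChannel_apply, hσ.2, mul_one, fromBlocks_smul, smul_zero, smul_zero, smul_smul,
      smul_smul]
    push_cast
    rfl
  rw [h]
  refine HasSpectrum.fromBlocks ?_ ?_
  · simpa [mul_assoc] using hσ.1.1.hasSpectrum_smul (w * (1 - p))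
  · convert hasSpectrum_diagonal (fun _ : Unit => w * p) using 1
    ext i j
    simp

theorem mutualInfo_erasureChannel {X : Type*} [Fintype X] [DecidableEq X] {w : X → ℝ}
    (hw0 : ∀ x, 0 ≤ w x) (hw : ∑ x, w x = 1) {σ : X → Matrix (Fin d) (Fin d) ℂ}
    (hσ : ∀ x, IsDensity (σ x)) :
    mutualInfo (idTensor X (erasureChannel p d)
        (∑ x, (w x : ℂ) • (Matrix.single x x (1 : ℂ) ⊗ₖ σ x))) =
      (1 - p) * (∑ i, negMulLog ((isDensity_average hw0 hw hσ).1.1.eigenvalues i) -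
        ∑ x, w x * ∑ i, negMulLog ((hσ x).1.1.eigenvalues i)) / log 2 := by
  have htr : ∀ x, (erasureChannel p d (σ x)).trace = 1 := fun x => by
    rw [erasureChannel_apply, (hσ x).2, Matrix.trace, Fintype.sum_sum_type]
    have := (hσ x).2
    rw [Matrix.trace] at this
    simp only [diag_apply] at this
    simp [← Finset.mul_sum, this]
  have h1 : ∑ x, (w x : ℂ) • erasureChannel p d (σ x) =
      ((1 : ℝ) : ℂ) • erasureChannel p d (∑ x, (w x : ℂ) • σ x) := by
    simp
  rw [mutualInfo, idTensor_cq, traceSnd_cq _ _ htr, traceFst_cq, h1,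
    (hasSpectrum_diagonal w).vonNeumannEntropy,
    (hasSpectrum_erasureChannel p (isDensity_average hw0 hw hσ) 1).vonNeumannEntropy,
    (HasSpectrum.blockDiagonal fun x => hasSpectrum_erasureChannel p (hσ x) (w x)).vonNeumannEntropy,
    ← add_div, ← sub_div]
  congr 1
  rw [← entropy_identity_of_erasure (1 - p) hw (fun x => (hσ x).sum_eigenvalues)
    (isDensity_average hw0 hw hσ).sum_eigenvalues]
  simp [Fintype.sum_prod_type]

end Erasure

/-! ### Tight frames from the Weyl-Heisenberg group -/

section Frame

variable {d : ℕ} [NeZero d]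

/-- The permutation `i ↦ i - a` of `Fin d`, with `Fin d` identified with `ℤ/d`. -/
def cyclicShift (a : ZMod d) : Equiv.Perm (Fin d) :=
  ((ZMod.finEquiv d).toEquiv.trans (Equiv.subRight a)).trans (ZMod.finEquiv d).toEquiv.symm

/-- The image of the vector `z` under the Weyl-Heisenberg operator with shift `g.1` and phase
`g.2`. -/
noncomputable def weylVector (z : Fin d → ℂ) (g : ZMod d × ZMod d) : Fin d → ℂ := fun i =>
  ZMod.stdAddChar (g.2 * ZMod.finEquiv d i) * z (cyclicShift g.1 i)

theorem norm_stdAddChar (x : ZMod d) : ‖ZMod.stdAddChar x‖ = 1 := by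
  rw [ZMod.stdAddChar_apply]; exact Circle.norm_coe _

theorem norm_weylVector (z : EuclideanSpace ℂ (Fin d)) (g : ZMod d × ZMod d) :
    ‖(WithLp.toLp 2 (weylVector z g) : EuclideanSpace ℂ (Fin d))‖ = ‖z‖ := by
  rw [EuclideanSpace.norm_eq, EuclideanSpace.norm_eq]
  congr 1
  simp only [weylVector, norm_mul, norm_stdAddChar, one_mul]
  exact Equiv.sum_comp (cyclicShift g.1) fun i => ‖z i‖ ^ 2

/-- The adjoint of a Weyl-Heisenberg operator preserves norms. -/
theorem exists_inner_weylVector (u : EuclideanSpace ℂ (Fin d)) (g : ZMod d × ZMod d) :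
    ∃ v : EuclideanSpace ℂ (Fin d), ‖v‖ = ‖u‖ ∧
      ∀ z : EuclideanSpace ℂ (Fin d), inner ℂ u (WithLp.toLp 2 (weylVector z g)) = inner ℂ v z := by
  refine ⟨WithLp.toLp 2 fun j => star (ZMod.stdAddChar
    (g.2 * ZMod.finEquiv d ((cyclicShift g.1).symm j))) * u ((cyclicShift g.1).symm j), ?_, ?_⟩
  · rw [EuclideanSpace.norm_eq, EuclideanSpace.norm_eq]
    congr 1
    simp only [norm_mul, norm_star, norm_stdAddChar, one_mul]
    exact Equiv.sum_comp (cyclicShift g.1).symm fun i => ‖u i‖ ^ 2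
  · intro z
    simp only [PiLp.inner_apply, weylVector]
    symm
    rw [← Equiv.sum_comp (cyclicShift g.1)]
    refine Finset.sum_congr rfl fun i _ => ?_
    simp only [Equiv.symm_apply_apply, RCLike.inner_apply, map_mul, RCLike.star_def,
      RCLike.conj_conj]
    ring

theorem sum_vecMulVec_weylVector (z : EuclideanSpace ℂ (Fin d)) (hz : ‖z‖ = 1) :
    ∑ g, vecMulVec (weylVector z g) (star (weylVector z g)) = (d : ℂ) • 1 := by
  ext i j
  rw [Matrix.sum_apply, Fintype.sum_prod_type]
  have hconj : ∀ x : ZMod d, star (ZMod.stdAddChar x : ℂ) = ZMod.stdAddChar (-x) := fun x => by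
    rw [AddChar.map_neg_eq_conj]; rfl
  have h1 : ∀ a b : ZMod d, vecMulVec (weylVector z (a, b)) (star (weylVector z (a, b))) i j =
      ZMod.stdAddChar (b * (ZMod.finEquiv d i - ZMod.finEquiv d j)) *
        (z (cyclicShift a i) * star (z (cyclicShift a j))) := fun a b => by
    rw [vecMulVec_apply, Pi.star_apply]
    simp only [weylVector]
    rw [star_mul', hconj, mul_sub, sub_eq_add_neg, AddChar.map_add_eq_mul]
    ring
  simp only [h1, ← Finset.sum_mul, AddChar.sum_mulShift _ (ZMod.isPrimitive_stdAddChar d),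
    sub_eq_zero, (ZMod.finEquiv d).injective.eq_iff, ← Finset.mul_sum]
  by_cases hij : i = j
  · subst hij
    have h2 : ∑ a : ZMod d, z (cyclicShift a i) * star (z (cyclicShift a i)) = 1 := by
      let e : ZMod d ≃ Fin d :=
        (Equiv.subLeft (ZMod.finEquiv d i)).trans (ZMod.finEquiv d).toEquiv.symm
      have h3 := e.sum_comp fun k => z k * star (z k)
      refine Eq.trans h3 ?_
      have h4 : ∀ k, z k * star (z k) = ((‖z k‖ ^ 2 : ℝ) : ℂ) := fun k => by
        rw [RCLike.star_def, Complex.mul_conj, Complex.normSq_eq_norm_sq]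
      simp only [h4]
      rw [← Complex.ofReal_sum, ← EuclideanSpace.norm_sq_eq, hz]
      simp
    rw [h2]
    simp [ZMod.card]
  · simp [hij]

/-- The orbit of a well chosen unit vector under the Weyl-Heisenberg operators is a tight frame in
which the unit vectors `u k` have small entropy on average. -/
theorem exists_tight_frame {κ : Type*} [Fintype κ] (c : κ → ℝ)
    (u : κ → EuclideanSpace ℂ (Fin d)) (hu : ∀ k, ‖u k‖ = 1) :
    ∃ z : ZMod d × ZMod d → EuclideanSpace ℂ (Fin d), (∀ g, ‖z g‖ = 1) ∧
      ∑ g, vecMulVec (z g) (star (z g : Fin d → ℂ)) = (d : ℂ) • 1 ∧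
      ∑ k, c k * ∑ g, negMulLog (‖inner ℂ (u k) (z g)‖ ^ 2) / d ≤
        (∑ k, c k) * (harmonic d - 1) := by
  choose v hv hvz using fun k => exists_inner_weylVector (u k)
  -- moving the operators to the other side leaves a single random vector `z` to choose
  obtain ⟨z, hz, hle⟩ := exists_unit_vector_entropy_le
    (fun kg : κ × (ZMod d × ZMod d) => c kg.1 / d) (fun kg => v kg.1 kg.2)
    (fun kg => (hv kg.1 kg.2).trans (hu kg.1))
  refine ⟨fun g => WithLp.toLp 2 (weylVector z g), fun g => (norm_weylVector z g).trans hz,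
    sum_vecMulVec_weylVector z hz, ?_⟩
  have hd : (d : ℝ) ≠ 0 := by exact_mod_cast NeZero.ne d
  rw [Fintype.sum_prod_type, Fintype.sum_prod_type] at hle
  refine Eq.trans_le ?_ (hle.trans_eq ?_)
  · refine Finset.sum_congr rfl fun k _ => ?_
    rw [Finset.mul_sum]
    refine Finset.sum_congr rfl fun g _ => ?_
    rw [hvz]
    ring
  · simp only [Finset.sum_const, Finset.card_univ, Fintype.card_prod, ZMod.card, Fintype.card_fin,
      nsmul_eq_mul]
    rw [← Finset.mul_sum, ← Finset.sum_div]
    push_cast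
    field_simp

end Frame

section FrameEntropy

variable {ι γ : Type*} [Fintype ι] [Fintype γ]

/-- Subadditivity of `-x log x`. -/
theorem negMulLog_sum_le {a : ι → ℝ} (ha : ∀ i, 0 ≤ a i) :
    negMulLog (∑ i, a i) ≤ ∑ i, negMulLog (a i) := by
  rw [negMulLog, neg_mul, Finset.sum_mul, ← Finset.sum_neg_distrib]
  refine Finset.sum_le_sum fun i hi => ?_
  rw [negMulLog, neg_mul]
  rcases (ha i).eq_or_lt with h | h
  · simp [← h]
  · have := log_le_log h (Finset.single_le_sum (fun j _ => ha j) hi)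
    gcongr

/-- The factor `1 / d` in the outcome probabilities of a frame measurement adds `log d` to the
outcome entropy. -/
theorem sum_negMulLog_div {d : ℕ} (hd : 1 ≤ d) {l : ι → ℝ} (hl1 : ∑ i, l i = 1)
    {t : γ → ι → ℝ} (ht2 : ∀ i, ∑ g, t g i = d) :
    ∑ g, negMulLog ((∑ i, l i * t g i) / d) =
      (∑ g, negMulLog (∑ i, l i * t g i)) / d + log d := by
  have hd' : (0 : ℝ) < d := by exact_mod_cast hd
  have h1 : ∑ g, ∑ i, l i * t g i = d := by
    rw [Finset.sum_comm]
    simp only [← Finset.mul_sum, ht2]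
    rw [← Finset.sum_mul, hl1, one_mul]
  have h2 : negMulLog (d : ℝ)⁻¹ = log d / d := by
    rw [negMulLog, log_inv]; field_simp
  simp only [div_eq_mul_inv, negMulLog_mul, Finset.sum_add_distrib, ← Finset.sum_mul,
    ← Finset.mul_sum, h1, h2]
  field_simp

/-- A measurement built from a tight frame of `d`-dimensional unit vectors has outcome entropy at
least the entropy of the spectrum plus `log d`. Here `t g i` is the squared inner product of the
frame vector `g` with the eigenvector `i`. -/
theorem le_sum_negMulLog_frame {d : ℕ} (hd : 1 ≤ d) {l : ι → ℝ} (hl : ∀ i, 0 ≤ l i)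
    (hl1 : ∑ i, l i = 1) {t : γ → ι → ℝ} (ht : ∀ g i, 0 ≤ t g i) (ht1 : ∀ g, ∑ i, t g i = 1)
    (ht2 : ∀ i, ∑ g, t g i = d) :
    ∑ i, negMulLog (l i) + log d ≤ ∑ g, negMulLog ((∑ i, l i * t g i) / d) := by
  have hd' : (0 : ℝ) < d := by exact_mod_cast hd
  rw [sum_negMulLog_div hd hl1 ht2]
  gcongr
  rw [le_div_iff₀ hd']
  calc (∑ i, negMulLog (l i)) * d = ∑ g, ∑ i, t g i * negMulLog (l i) := by
        rw [Finset.sum_comm, Finset.sum_mul]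
        simp only [← Finset.sum_mul, ht2, mul_comm]
    _ ≤ _ := Finset.sum_le_sum fun g _ => by
        have := concaveOn_negMulLog.le_map_sum (t := Finset.univ) (w := t g) (p := l)
          (fun i _ => ht g i) (ht1 g) (fun i _ => hl i)
        simpa only [smul_eq_mul, mul_comm (l _)] using this

/-- The outcome entropy of a frame measurement exceeds the entropy of the spectrum plus `log d` by
at most the average of the entropies of the eigenvectors. -/
theorem sum_negMulLog_frame_le {d : ℕ} (hd : 1 ≤ d) {l : ι → ℝ} (hl : ∀ i, 0 ≤ l i)
    (hl1 : ∑ i, l i = 1) {t : γ → ι → ℝ} (ht : ∀ g i, 0 ≤ t g i)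
    (ht2 : ∀ i, ∑ g, t g i = d) :
    ∑ g, negMulLog ((∑ i, l i * t g i) / d) ≤
      ∑ i, negMulLog (l i) + log d + ∑ i, l i * ∑ g, negMulLog (t g i) / d := by
  have hd' : (0 : ℝ) < d := by exact_mod_cast hd
  rw [sum_negMulLog_div hd hl1 ht2]
  have h1 : ∑ g, negMulLog (∑ i, l i * t g i) ≤
      (∑ i, negMulLog (l i)) * d + ∑ i, l i * ∑ g, negMulLog (t g i) := by
    calc _ ≤ ∑ g, ∑ i, negMulLog (l i * t g i) :=
          Finset.sum_le_sum fun g _ => negMulLog_sum_le fun i => mul_nonneg (hl i) (ht g i)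
      _ = _ := by
          rw [Finset.sum_comm, Finset.sum_mul, ← Finset.sum_add_distrib]
          refine Finset.sum_congr rfl fun i _ => ?_
          simp only [negMulLog_mul, Finset.sum_add_distrib, ← Finset.sum_mul, ← Finset.mul_sum, ht2]
          ring
  have h2 : ∑ i, l i * ∑ g, negMulLog (t g i) / d = (∑ i, l i * ∑ g, negMulLog (t g i)) / d := by
    simp only [← Finset.sum_div, ← mul_div_assoc]
  have h3 := div_le_div_of_nonneg_right h1 hd'.le
  rw [add_div, mul_div_cancel_right₀ _ hd'.ne'] at h3
  rw [h2]
  linarith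

end FrameEntropy

section QuadraticForm

variable {n : Type*} [Fintype n] [DecidableEq n]

theorem star_dotProduct_mulVec_eq_sum {σ : Matrix n n ℂ} (h : σ.IsHermitian)
    (z : EuclideanSpace ℂ n) :
    star (z : n → ℂ) ⬝ᵥ σ *ᵥ z =
      ((∑ i, h.eigenvalues i * ‖inner ℂ (h.eigenvectorBasis i) z‖ ^ 2 : ℝ) : ℂ) := by
  have h1 := h.eigenvectorBasis.sum_inner_mul_inner z (WithLp.toLp 2 (σ *ᵥ z))
  rw [EuclideanSpace.inner_eq_star_dotProduct, dotProduct_comm] at h1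
  rw [← h1, Complex.ofReal_sum]
  refine Finset.sum_congr rfl fun i _ => ?_
  have h3 : star (h.eigenvectorBasis i : n → ℂ) ᵥ* σ =
      star ((h.eigenvalues i : ℂ) • (h.eigenvectorBasis i : n → ℂ)) := by
    have := star_mulVec σ (h.eigenvectorBasis i)
    rw [h.eq, h.mulVec_eigenvectorBasis] at this
    exact this.symm
  have h2 : inner ℂ (h.eigenvectorBasis i) (WithLp.toLp 2 (σ *ᵥ z)) =
      h.eigenvalues i * inner ℂ (h.eigenvectorBasis i) z := by
    rw [EuclideanSpace.inner_eq_star_dotProduct, EuclideanSpace.inner_eq_star_dotProduct,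
      dotProduct_comm, dotProduct_mulVec, h3, dotProduct_comm]
    simp [dotProduct_smul]
  rw [h2, ← inner_conj_symm, mul_left_comm, Complex.conj_mul', Complex.ofReal_mul,
    Complex.ofReal_pow]

theorem sum_norm_inner_sq_of_frame {d : ℕ} {γ : Type*} [Fintype γ] {z : γ → EuclideanSpace ℂ n}
    (hz : ∑ g, vecMulVec (z g) (star (z g : n → ℂ)) = (d : ℂ) • 1)
    {v : EuclideanSpace ℂ n} (hv : ‖v‖ = 1) : ∑ g, ‖inner ℂ v (z g)‖ ^ 2 = d := by
  have h1 := congrArg (fun M => star (v : n → ℂ) ⬝ᵥ M *ᵥ v) hz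
  simp only [sum_mulVec, dotProduct_sum, smul_mulVec, one_mulVec, dotProduct_smul] at h1
  have h2 : star (v : n → ℂ) ⬝ᵥ v = 1 := by
    rw [dotProduct_comm, ← EuclideanSpace.inner_eq_star_dotProduct, inner_self_eq_norm_sq_to_K, hv]
    simp
  have h3 : ∀ g, star (v : n → ℂ) ⬝ᵥ vecMulVec (z g) (star (z g : n → ℂ)) *ᵥ v =
      ((‖inner ℂ v (z g)‖ ^ 2 : ℝ) : ℂ) := fun g => by
    have h4 : star (v : n → ℂ) ⬝ᵥ z g = inner ℂ v (z g) := by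
      rw [EuclideanSpace.inner_eq_star_dotProduct, dotProduct_comm]
    have h5 : star (z g : n → ℂ) ⬝ᵥ v = inner ℂ (z g) v := by
      rw [EuclideanSpace.inner_eq_star_dotProduct, dotProduct_comm]
    rw [vecMulVec_mulVec, dotProduct_smul, h4, h5, op_smul_eq_mul,
      ← inner_conj_symm (z g) v, Complex.mul_conj', Complex.ofReal_pow]
  simp only [h2, h3] at h1
  rw [← Complex.ofReal_sum] at h1
  exact_mod_cast (by simpa using h1 : ((∑ g, ‖inner ℂ v (z g)‖ ^ 2 : ℝ) : ℂ) = d)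

end QuadraticForm

/-! ### Measurements of the environment -/

theorem eq_of_forall_trace_mul {n : Type*} [Fintype n] [DecidableEq n] {A B : Matrix n n ℂ}
    (h : ∀ ρ, (A * ρ).trace = (B * ρ).trace) : A = B := by
  ext i j
  have := h (Matrix.single j i 1)
  simpa [trace_mul_single] using this

section Complement

variable {d : ℕ} {e : Type*} [Fintype e] [DecidableEq e]

/-- A measurement of the environment of the erasure channel can simulate, with probability `p`, any
measurement of the channel input: `Φ` pulls effects on the input back to effects on the
environment. -/
theorem exists_effect_map {p : ℝ} (hp : 0 ≤ p)
    {Nc : Matrix (Fin d) (Fin d) ℂ →ₗ[ℂ] Matrix e e ℂ}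
    (h : IsComplementary (erasureChannel p d) Nc) :
    ∃ Φ : Matrix (Fin d) (Fin d) ℂ →ₗ[ℂ] Matrix e e ℂ,
      (∀ M, M.PosSemidef → (Φ M).PosSemidef) ∧ (1 - Φ 1).PosSemidef ∧
      (∀ σ M, (Nc σ * Φ M).trace = p * (σ * M).trace) ∧ ∀ σ, (Nc σ).trace = σ.trace := by
  obtain ⟨V, hV, hN, hNc⟩ := h
  -- the Kraus operators of the complementary channel
  let K : Fin d ⊕ Unit → Matrix e (Fin d) ℂ := fun i => Matrix.of fun k s => V (i, k) s
  have hVV : ∀ (ρ : Matrix (Fin d) (Fin d) ℂ) i j k l,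
      (V * ρ * Vᴴ) (i, k) (j, l) = (K i * ρ * (K j)ᴴ) k l := fun ρ i j k l => by
    simp [K, mul_apply]
  have hNK : ∀ ρ i j, erasureChannel p d ρ i j = ((K j)ᴴ * K i * ρ).trace := fun ρ i j => by
    rw [hN, ← Matrix.trace_mul_cycle]
    simp only [traceSnd, of_apply, hVV]
    rfl
  have hNcK : ∀ ρ, Nc ρ = ∑ i, K i * ρ * (K i)ᴴ := fun ρ => by
    ext k l
    rw [hNc, Matrix.sum_apply]
    simp only [traceFst, of_apply, hVV]
  have hp1 : (K (Sum.inr ()))ᴴ * K (Sum.inr ()) = (p : ℂ) • 1 := eq_of_forall_trace_mul fun ρ => by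
    rw [← hNK, erasureChannel_apply]
    simp
  have hp0 : ∀ s, (K (Sum.inl s))ᴴ * K (Sum.inr ()) = 0 := fun s =>
      eq_of_forall_trace_mul fun ρ => by
    rw [← hNK, erasureChannel_apply]
    simp
  set W := K (Sum.inr ()) with hW
  let Φ : Matrix (Fin d) (Fin d) ℂ →ₗ[ℂ] Matrix e e ℂ :=
    { toFun := fun M => ((p⁻¹ : ℝ) : ℂ) • (W * M * Wᴴ)
      map_add' := fun A B => by rw [Matrix.mul_add, Matrix.add_mul, smul_add]
      map_smul' := fun c A => by
        rw [Matrix.mul_smul, Matrix.smul_mul, smul_comm]; rfl }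
  have hΦ : ∀ M, Φ M = ((p⁻¹ : ℝ) : ℂ) • (W * M * Wᴴ) := fun _ => rfl
  have hpos : ∀ M, M.PosSemidef → (Φ M).PosSemidef := fun M hM => by
    rw [hΦ]
    exact (hM.mul_mul_conjTranspose_same W).smul (by exact_mod_cast inv_nonneg.2 hp)
  refine ⟨Φ, hpos, ?_, ?_, ?_⟩
  · -- `Φ 1` is the projection onto the range of `W`, and vanishes for `p = 0`
    have hh : (Φ 1).IsHermitian := (hpos 1 PosSemidef.one).1
    have hi : Φ 1 * Φ 1 = Φ 1 := by
      have h1 : W * Wᴴ * (W * Wᴴ) = (p : ℂ) • (W * Wᴴ) := by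
        rw [Matrix.mul_assoc, ← Matrix.mul_assoc Wᴴ, hp1]; simp
      rw [hΦ, Matrix.mul_one, smul_mul_smul_comm, h1, smul_smul]
      congr 1
      rcases eq_or_ne p 0 with rfl | hp'
      · simp
      · rw [mul_assoc, ← Complex.ofReal_mul, inv_mul_cancel₀ hp', Complex.ofReal_one, mul_one]
    have h2 : 1 - Φ 1 = (1 - Φ 1)ᴴ * (1 - Φ 1) := by
      rw [conjTranspose_sub, conjTranspose_one, hh.eq, Matrix.sub_mul, Matrix.mul_sub,
        Matrix.mul_sub, hi]
      simp
    rw [h2]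
    exact posSemidef_conjTranspose_mul_self _
  · intro σ M
    have h1 : ∀ s, K (Sum.inl s) * σ * (K (Sum.inl s))ᴴ * (W * M * Wᴴ) = 0 := fun s => by
      rw [Matrix.mul_assoc (K (Sum.inl s) * σ), ← Matrix.mul_assoc _ (W * M),
        ← Matrix.mul_assoc _ W, hp0]
      simp
    have h2 : (W * σ * Wᴴ * (W * M * Wᴴ)).trace = p * (p * (σ * M).trace) := by
      rw [Matrix.mul_assoc (W * σ), ← Matrix.mul_assoc _ (W * M), ← Matrix.mul_assoc _ W, hp1,
        Matrix.trace_mul_comm, Matrix.mul_assoc _ _ (W * σ), ← Matrix.mul_assoc Wᴴ, hp1]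
      simp only [Matrix.smul_mul, Matrix.mul_smul, Matrix.one_mul, trace_smul, smul_eq_mul]
      rw [Matrix.trace_mul_comm]
    rw [hNcK, hΦ, Matrix.mul_smul, trace_smul, Finset.sum_mul, Fintype.sum_sum_type]
    simp only [h1, Finset.sum_const_zero, zero_add, Finset.univ_unique, Finset.sum_singleton,
      PUnit.default_eq_unit, ← hW, h2, smul_eq_mul]
    -- for `p = 0` both sides vanish, since then `p⁻¹ = 0`
    rcases eq_or_ne p 0 with rfl | hp'
    · simp
    · rw [← mul_assoc, ← Complex.ofReal_mul, inv_mul_cancel₀ hp', Complex.ofReal_one, one_mul]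
  · intro σ
    have h1 : (Nc σ).trace = (V * σ * Vᴴ).trace := by
      rw [hNc]
      simp only [traceFst, Matrix.trace, Fintype.sum_prod_type, diag_apply, of_apply]
      exact Finset.sum_comm
    rw [h1, Matrix.trace_mul_cycle, hV, Matrix.one_mul]

end Complement

section Accessible

variable {X Y e : Type*} [Fintype X] [Fintype e]

theorem shannonMutualInfo_comp_equiv {Z : Type*} [Fintype Y] [Fintype Z] (f : Z ≃ Y) (P : X × Y → ℝ) :
    shannonMutualInfo (fun z : X × Z => P (z.1, f z.2)) = shannonMutualInfo P := by
  rw [shannonMutualInfo, shannonMutualInfo]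
  congr 1
  · congr 1
    · congr 1
      ext x
      exact f.sum_comp fun y => P (x, y)
    · exact shannonEntropy_comp_equiv f fun y => ∑ x, P (x, y)
  · exact shannonEntropy_comp_equiv ((Equiv.refl X).prodCongr f) P

theorem le_accessibleInfo [Fintype Y] [DecidableEq X] [DecidableEq e]
    (ρ : Matrix (X × e) (X × e) ℂ) {Γ : Y → Matrix e e ℂ} (hΓ : IsPOVM Γ) :
    (shannonMutualInfo (outcomeDist ρ Γ) : EReal) ≤ accessibleInfo ρ := by
  let f := (Fintype.equivFin Y).symm
  have hf : IsPOVM fun k => Γ (f k) := ⟨fun k => hΓ.1 _, (f.sum_comp Γ).trans hΓ.2⟩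
  have h : shannonMutualInfo (outcomeDist ρ fun k => Γ (f k)) =
      shannonMutualInfo (outcomeDist ρ Γ) := shannonMutualInfo_comp_equiv f (outcomeDist ρ Γ)
  rw [← h, accessibleInfo]
  exact le_iSup_of_le _ (le_iSup_of_le _ (le_iSup_of_le hf le_rfl))

theorem outcomeDist_cq [DecidableEq X] {a : Type*}
    (N : Matrix a a ℂ →ₗ[ℂ] Matrix e e ℂ) (w : X → ℝ)
    (σ : X → Matrix a a ℂ) (Γ : Y → Matrix e e ℂ) (z : X × Y) :
    outcomeDist (idTensor X N (∑ x, (w x : ℂ) • (Matrix.single x x (1 : ℂ) ⊗ₖ σ x))) Γ z =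
      w z.1 * (N (σ z.1) * Γ z.2).trace.re := by
  obtain ⟨x, y⟩ := z
  rw [outcomeDist, idTensor_cq, ← Complex.re_ofReal_mul]
  congr 1
  simp only [Matrix.trace, diag_apply, mul_apply, Fintype.sum_prod_type, submatrix_apply, Prod.swap,
    blockDiagonal_apply, kroneckerMap_apply, Matrix.single_apply]
  rw [Finset.sum_eq_single x]
  · rw [Finset.mul_sum]
    refine Finset.sum_congr rfl fun s _ => ?_
    rw [Finset.sum_eq_single x, Finset.mul_sum]
    · simp [mul_assoc]
    · intro x' _ hx'; simp [hx'.symm]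
    · simp
  · intro x' _ hx'
    simp [hx'.symm]
  · simp

/-- Mutual information of a joint distribution in which the second variable is erased with
probability `1 - c`. -/
theorem shannonMutualInfo_of_erasure {γ : Type*} [Fintype γ] (c : ℝ) {w : X → ℝ}
    (hw : ∑ x, w x = 1) {r : X → γ → ℝ} (hr : ∀ x, ∑ g, r x g = 1) {P : X × Option γ → ℝ}
    (hs : ∀ x g, P (x, some g) = w x * (c * r x g)) (hn : ∀ x, P (x, none) = w x * (1 - c)) :
    shannonMutualInfo P = c * (∑ g, negMulLog (∑ x, w x * r x g) -
      ∑ x, w x * ∑ g, negMulLog (r x g)) / log 2 := by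
  have hm : ∑ g, ∑ x, w x * r x g = 1 := by
    rw [Finset.sum_comm]
    simp only [← Finset.mul_sum, hr, mul_one, hw]
  have h1 : ∀ x, ∑ y, P (x, y) = w x := fun x => by
    simp only [Fintype.sum_option, hs, hn, ← Finset.mul_sum, hr]
    ring
  have h2 : ∀ g, ∑ x, P (x, some g) = c * ∑ x, w x * r x g := fun g => by
    rw [Finset.mul_sum]
    exact Finset.sum_congr rfl fun x _ => by rw [hs]; ring
  have h3 : ∑ x, P (x, none) = 1 - c := by
    simp only [hn, ← Finset.sum_mul, hw, one_mul]
  rw [← entropy_identity_of_erasure c hw hr hm, shannonMutualInfo,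
    shannonEntropy_eq_sum_negMulLog, shannonEntropy_eq_sum_negMulLog,
    shannonEntropy_eq_sum_negMulLog, ← add_div, ← sub_div]
  simp only [h1, Fintype.sum_option, h2, h3]
  simp only [Fintype.sum_prod_type, Fintype.sum_option, hs, hn]
  congr 1
  simp only [add_comm]

end Accessible

/-! ### The bound on the locking information -/

section Bound

theorem gammaSeq_eq {d : ℕ} (hd : 1 ≤ d) : gammaSeq d = log d - (harmonic d - 1) := by
  have h : (harmonic d : ℝ) = 1 + ∑ t ∈ Finset.Icc 2 d, (1 : ℝ) / t := by
    rw [harmonic_eq_sum_Icc, ← Finset.add_sum_Ioc_eq_sum_Icc hd]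
    push_cast
    simp only [one_div, inv_one]
    rfl
  rw [gammaSeq, h]
  ring

theorem tendsto_gammaSeq :
    Filter.Tendsto gammaSeq Filter.atTop (nhds (1 - eulerMascheroniConstant)) := by
  refine (tendsto_harmonic_sub_log.const_sub 1).congr' ?_
  filter_upwards [Filter.eventually_ge_atTop 1] with d hd
  rw [gammaSeq_eq hd]
  ring

/-- The uniform distribution maximizes the entropy. -/
theorem sum_negMulLog_le_log_card {ι : Type*} [Fintype ι] [Nonempty ι] {l : ι → ℝ}
    (hl : ∀ i, 0 ≤ l i) (hl1 : ∑ i, l i = 1) :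
    ∑ i, negMulLog (l i) ≤ log (Fintype.card ι) := by
  set D : ℝ := (Fintype.card ι : ℝ) with hD
  have hD0 : 0 < D := by simp [hD, Fintype.card_pos]
  have h1 : ∑ i, negMulLog (D * l i) ≤ ∑ i, (1 - D * l i) :=
    Finset.sum_le_sum fun i _ => negMulLog_le_one_sub_self (mul_nonneg hD0.le (hl i))
  simp only [negMulLog_mul, Finset.sum_add_distrib, ← Finset.sum_mul, ← Finset.mul_sum, hl1,
    Finset.sum_sub_distrib, Finset.sum_const, Finset.card_univ, nsmul_eq_mul, ← hD] at h1
  rw [negMulLog] at h1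
  have h2 : D * ∑ i, negMulLog (l i) ≤ D * log D := by linarith
  exact le_of_mul_le_mul_left h2 hD0

variable {d : ℕ} {X : Type*} [Fintype X]

/-- Lower bound on the information that a frame measurement extracts from an ensemble: the Holevo
quantity, in nats, minus `harmonic d - 1`, the average of the Shannon entropy of the squared
moduli of the coordinates of a random unit vector. -/
theorem exists_frame_information_ge [NeZero d] {w : X → ℝ} (hw0 : ∀ x, 0 ≤ w x) (hw : ∑ x, w x = 1)
    {σ : X → Matrix (Fin d) (Fin d) ℂ} (hσ : ∀ x, IsDensity (σ x)) :
    ∃ M : ZMod d × ZMod d → Matrix (Fin d) (Fin d) ℂ, IsPOVM M ∧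
      ∑ i, negMulLog ((isDensity_average hw0 hw hσ).1.1.eigenvalues i) -
          ∑ x, w x * ∑ i, negMulLog ((hσ x).1.1.eigenvalues i) - (harmonic d - 1) ≤
        ∑ g, negMulLog (∑ x, w x * (σ x * M g).trace.re) -
          ∑ x, w x * ∑ g, negMulLog (σ x * M g).trace.re := by
  have hd : 1 ≤ d := NeZero.one_le
  have hd0 : (d : ℂ) ≠ 0 := by exact_mod_cast NeZero.ne d
  obtain ⟨z, hz1, hz, hle⟩ := exists_tight_frame
    (fun k : X × Fin d => w k.1 * (hσ k.1).1.1.eigenvalues k.2)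
    (fun k => (hσ k.1).1.1.eigenvectorBasis k.2)
    (fun k => (hσ k.1).1.1.eigenvectorBasis.orthonormal.1 k.2)
  have hc : ∑ k : X × Fin d, w k.1 * (hσ k.1).1.1.eigenvalues k.2 = 1 := by
    simp only [Fintype.sum_prod_type, ← Finset.mul_sum, (hσ _).sum_eigenvalues, mul_one, hw]
  rw [hc, one_mul, Fintype.sum_prod_type] at hle
  refine ⟨fun g => ((d⁻¹ : ℝ) : ℂ) • vecMulVec (z g) (star (z g : Fin d → ℂ)),
    ⟨fun g => ?_, ?_⟩, ?_⟩
  · exact (posSemidef_vecMulVec_self_star _).smul (by exact_mod_cast inv_nonneg.2 d.cast_nonneg)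
  · rw [← Finset.smul_sum, hz, smul_smul]
    simp [hd0]
  have htr : ∀ {τ : Matrix (Fin d) (Fin d) ℂ} (hτ : IsDensity τ) g,
      (τ * ((d⁻¹ : ℝ) : ℂ) • vecMulVec (z g) (star (z g : Fin d → ℂ))).trace.re =
        (∑ i, hτ.1.1.eigenvalues i * ‖inner ℂ (hτ.1.1.eigenvectorBasis i) (z g)‖ ^ 2) / d := by
    intro τ hτ g
    rw [Matrix.mul_smul, trace_smul, mul_vecMulVec, trace_vecMulVec, dotProduct_comm,
      star_dotProduct_mulVec_eq_sum hτ.1.1, smul_eq_mul, ← Complex.ofReal_mul, Complex.ofReal_re,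
      inv_mul_eq_div]
  have ht0 : ∀ {τ : Matrix (Fin d) (Fin d) ℂ} (hτ : IsDensity τ) g i,
      0 ≤ ‖inner ℂ (hτ.1.1.eigenvectorBasis i) (z g)‖ ^ 2 := fun _ _ _ => by positivity
  have ht2 : ∀ {τ : Matrix (Fin d) (Fin d) ℂ} (hτ : IsDensity τ) i,
      ∑ g, ‖inner ℂ (hτ.1.1.eigenvectorBasis i) (z g)‖ ^ 2 = d := fun hτ i =>
    sum_norm_inner_sq_of_frame hz (hτ.1.1.eigenvectorBasis.orthonormal.1 i)
  have hav := isDensity_average hw0 hw hσ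
  have hm : ∀ g, ∑ x, w x * (σ x * ((d⁻¹ : ℝ) : ℂ) •
      vecMulVec (z g) (star (z g : Fin d → ℂ))).trace.re =
      (∑ i, hav.1.1.eigenvalues i * ‖inner ℂ (hav.1.1.eigenvectorBasis i) (z g)‖ ^ 2) / d := by
    intro g
    rw [← htr hav, Finset.sum_mul, trace_sum, Complex.re_sum]
    refine Finset.sum_congr rfl fun x _ => ?_
    rw [Matrix.smul_mul, trace_smul, smul_eq_mul, Complex.re_ofReal_mul]
  have hA := le_sum_negMulLog_frame hd hav.1.eigenvalues_nonneg hav.sum_eigenvalues (ht0 hav)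
    (fun g => by
      rw [hav.1.1.eigenvectorBasis.sum_sq_norm_inner_right, hz1, one_pow]) (ht2 hav)
  have hB := Finset.sum_le_sum fun x (_ : x ∈ Finset.univ) => mul_le_mul_of_nonneg_left
    (sum_negMulLog_frame_le hd (hσ x).1.eigenvalues_nonneg (hσ x).sum_eigenvalues (ht0 (hσ x))
      (ht2 (hσ x))) (hw0 x)
  simp only [mul_add, Finset.sum_add_distrib, ← Finset.sum_mul, hw, one_mul] at hB
  have hC : ∑ x, w x * ∑ i, (hσ x).1.1.eigenvalues i *
      ∑ g, negMulLog (‖inner ℂ ((hσ x).1.1.eigenvectorBasis i) (z g)‖ ^ 2) / d ≤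
        harmonic d - 1 := by
    refine Eq.trans_le ?_ hle
    simp only [Finset.mul_sum, mul_assoc]
  simp only [hm]
  simp only [htr (hσ _)]
  linarith

/-- The measurement of the environment that simulates, with probability `p`, a measurement of the
channel input extracts the fraction `p` of its information. -/
theorem le_accessibleInfo_complement [DecidableEq X] {p : ℝ} (hp : 0 ≤ p)
    {e : Type*} [Fintype e] [DecidableEq e]
    {Nc : Matrix (Fin d) (Fin d) ℂ →ₗ[ℂ] Matrix e e ℂ}
    (h : IsComplementary (erasureChannel p d) Nc) {w : X → ℝ} (hw : ∑ x, w x = 1)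
    {σ : X → Matrix (Fin d) (Fin d) ℂ} (hσ : ∀ x, IsDensity (σ x)) {γ : Type*} [Fintype γ]
    {M : γ → Matrix (Fin d) (Fin d) ℂ} (hM : IsPOVM M) :
    ((p * (∑ g, negMulLog (∑ x, w x * (σ x * M g).trace.re) -
          ∑ x, w x * ∑ g, negMulLog (σ x * M g).trace.re) / log 2 : ℝ) : EReal) ≤
      accessibleInfo (idTensor X Nc (∑ x, (w x : ℂ) • (Matrix.single x x (1 : ℂ) ⊗ₖ σ x))) := by
  obtain ⟨Φ, hpos, hone, htr, htr1⟩ := exists_effect_map hp h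
  let Γ : Option γ → Matrix e e ℂ := fun y => y.elim (1 - Φ 1) fun g => Φ (M g)
  have hΓ : IsPOVM Γ := by
    refine ⟨fun y => ?_, ?_⟩
    · cases y with
      | none => exact hone
      | some g => exact hpos _ (hM.1 g)
    · rw [Fintype.sum_option]
      simp only [Γ, Option.elim_none, Option.elim_some]
      rw [← map_sum, hM.2, sub_add_cancel]
  have hr : ∀ x, ∑ g, (σ x * M g).trace.re = 1 := fun x => by
    rw [← Complex.re_sum, ← trace_sum, ← Finset.mul_sum, hM.2, Matrix.mul_one, (hσ x).2,
      Complex.one_re]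
  rw [← shannonMutualInfo_of_erasure p hw hr
    (P := outcomeDist (idTensor X Nc (∑ x, (w x : ℂ) • (Matrix.single x x (1 : ℂ) ⊗ₖ σ x))) Γ)]
  · exact le_accessibleInfo _ hΓ
  · intro x g
    rw [outcomeDist_cq]
    simp only [Γ, Option.elim_some, htr, Complex.re_ofReal_mul]
  · intro x
    rw [outcomeDist_cq]
    simp only [Γ, Option.elim_none]
    rw [Matrix.mul_sub, Matrix.mul_one, trace_sub, htr, htr1, Matrix.mul_one, (hσ x).2]
    simp

theorem lockingInfo_erasureChannel_le [NeZero d] {p : ℝ} (hp : 0 ≤ p) (hp2 : p ≤ 1 / 2) :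
    lockingInfo (erasureChannel p d) ≤
      (((1 - p) * logb 2 d - p * gammaSeq d * logb 2 (exp 1) : ℝ) : EReal) := by
  refine iSup_le fun k => iSup_le fun Nc => iSup_le fun hNc => iSup_le fun n => iSup_le fun ρ =>
    iSup_le fun hρ => ?_
  obtain ⟨w, σ, hw0, hw, hσ, rfl⟩ := hρ
  obtain ⟨M, hM, hinfo⟩ := exists_frame_information_ge hw0 hw hσ
  refine (EReal.sub_le_sub le_rfl (le_accessibleInfo_complement hp hNc hw hσ hM)).trans ?_
  rw [mutualInfo_erasureChannel p hw0 hw hσ, ← EReal.coe_sub, EReal.coe_le_coe_iff, ← sub_div,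
    gammaSeq_eq NeZero.one_le, logb, logb, log_exp, mul_one_div, ← mul_div_assoc, ← sub_div]
  have hlog : 0 < log 2 := log_pos one_lt_two
  refine div_le_div_of_nonneg_right ?_ hlog.le
  have hav := isDensity_average hw0 hw hσ
  have h1 : ∑ i, negMulLog (hav.1.1.eigenvalues i) ≤ log d := by
    simpa using sum_negMulLog_le_log_card hav.1.eigenvalues_nonneg hav.sum_eigenvalues
  have h2 : 0 ≤ ∑ x, w x * ∑ i, negMulLog ((hσ x).1.1.eigenvalues i) :=
    Finset.sum_nonneg fun x _ => mul_nonneg (hw0 x) <| Finset.sum_nonneg fun i _ =>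
      negMulLog_nonneg ((hσ x).1.eigenvalues_nonneg i) <| by
        rw [← (hσ x).sum_eigenvalues]
        exact Finset.single_le_sum (fun j _ => (hσ x).1.eigenvalues_nonneg j) (Finset.mem_univ i)
  have h3 := mul_le_mul_of_nonneg_left hinfo hp
  have h4 := mul_le_mul_of_nonneg_left (h1.trans (le_add_of_nonneg_right h2))
    (show 0 ≤ 1 - 2 * p by linarith)
  linarith

end Bound

end QInfo

theorem lemma2 :
    (∀ (d : ℕ) (p : ℝ), 1 ≤ d → 0 ≤ p → p ≤ 1 / 2 →
      QInfo.lockingInfo (QInfo.erasureChannel p d) ≤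
        (((1 - p) * Real.logb 2 d
          - p * QInfo.gammaSeq d * Real.logb 2 (Real.exp 1) : ℝ) : EReal)) ∧
    Filter.Tendsto QInfo.gammaSeq Filter.atTop
      (nhds (1 - Real.eulerMascheroniConstant)) := by
  refine ⟨fun d p hd hp hp2 => ?_, QInfo.tendsto_gammaSeq⟩
  have : NeZero d := ⟨by lia⟩
  exact QInfo.lockingInfo_erasureChannel_le hp hp2
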